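/- Let $\overline{H_4}$ be the affine-Virasoro Nappi–Witten Lie algebra over $\mathbb C$: it has basis $p(m),q(m),r(m),s(m),d_m$ ($m\in\mathbb Z$) and $\mathbf k$, where $h(m)=h\otimes t^m$ and $h(0)$ is also written $h$; $\mathbf k$ is central and $$[p(m),q(n)]=r(m+n)+m\delta_{m+n,0}\mathbf k,\quad [s(m),p(n)]=p(m+n),\quad [s(m),q(n)]=-q(m+n),\quad [r(m),s(n)]=m\delta_{m+n,0}\mathbf k,$$ $$[d_m,h(n)]=n\,h(m+n)\ (h\in\{p,q,r,s\}),\qquad [d_m,d_n]=(n-m)d_{m+n}+\delta_{m+n,0}\tfrac{m^3-m}{12}\mathbf k,$$ all brackets of basis vectors that do not follow from these by antisymmetry being $0$. Let $\mathfrak b=\mathbb C d_0\oplus\mathbb C s$. For $\alpha\in\mathbb C^*$, $F,P,Q\in\mathbb C[s]$ and $R\in\mathbb C$ consider the following operators on $\mathbb C[s,d]$, where $m\in\mathbb Z$ and $x=x(s,d)$: $$p(m).x=\alpha^mP(s)\,x(s-1,d-m),\quad q(m).x=\alpha^mQ(s)\,x(s+1,d-m),\quad r(m).x=\alpha^mR\,x(s,d-m),$$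 $$s(m).x=\alpha^m s\,x(s,d-m),\quad d_m.x=\alpha^m\,(d+mF(s))\,x(s,d-m),\quad \mathbf k.x=0.$$ Theorem. (1) These operators make $\mathbb C[s,d]$ an $\overline{H_4}$-module that is free of rank one over $U(\mathfrak b)$ with free generator $1$, in each of the following two cases. (A) $\alpha\in\mathbb C^*$, $F=\lambda\in\mathbb C$ is a constant, and $(P,Q,R)$ is one of $(g,0,0)$ or $(0,g,0)$ with $0\ne g\in\mathbb C[s]$; $(a_1s+a_2,\,b,\,-a_1b)$ or $(b,\,a_1s+a_2,\,-a_1b)$ with $a_1,b\in\mathbb C^*$, $a_2\in\mathbb C$; $(a,b,0)$ with $a,b\in\mathbb C^*$. (B) $\alpha\in\mathbb C^*$, $F\in\mathbb C[s]$ is arbitrary, and $P=Q=R=0$. (2) Conversely, let $M$ be an $\overline{H_4}$-module that is free of rank one over $U(\mathfrak b)$, with free generator $v$. If $p.v\neq0$ or $q.v\ne0$, then $M$ is isomorphic, by an isomorphism that sends $v$ to $1$, to a module of type (A). If $p.v=q.v=0$, then $M$ is isomorphic, by an isomorphism that sends $v$ to $1$, to a module of type (B). -/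

import Mathlib

open Polynomial
open scoped Polynomial.Bivariate

noncomputable section

/-- Labels of the basis of the affine-Virasoro Nappi-Witten algebra: `p m` stands for `p ⊗ t ^ m`,
likewise `q m`, `r m`, `s m`; `d m` is the Virasoro element `d_m`, and `k` is the centre. -/
inductive NWIndex : Type
  | p (m : ℤ) | q (m : ℤ) | r (m : ℤ) | s (m : ℤ) | d (m : ℤ) | k

/-- The vector space `H₄ ⊗ ℂ[t, t⁻¹] ⊕ ℂ k ⊕ ⨁ ℂ d_m`, with its basis indexed by `NWIndex`. -/
def AffVirNW : Type := NWIndex →₀ ℂ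

namespace AffVirNW

instance instAddCommGroup : AddCommGroup AffVirNW := inferInstanceAs (AddCommGroup (NWIndex →₀ ℂ))
instance instModule : Module ℂ AffVirNW := inferInstanceAs (Module ℂ (NWIndex →₀ ℂ))

/-- The basis vector with a given label. -/
def e (i : NWIndex) : AffVirNW := Finsupp.single i (1 : ℂ)

/-- The linear map with prescribed values on the basis vectors. -/
def lin {V : Type*} [AddCommGroup V] [Module ℂ V] (f : NWIndex → V) : AffVirNW →ₗ[ℂ] V :=
  Finsupp.linearCombination ℂ f

theorem lin_e {V : Type*} [AddCommGroup V] [Module ℂ V] (f : NWIndex → V) (i : NWIndex) :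
    lin f (e i) = f i :=
  (Finsupp.linearCombination_single ℂ (1 : ℂ) i).trans (one_smul ℂ (f i))

theorem hom_ext {V : Type*} [AddCommGroup V] [Module ℂ V] {f g : AffVirNW →ₗ[ℂ] V}
    (h : ∀ i, f (e i) = g (e i)) : f = g :=
  Finsupp.lhom_ext' fun i => LinearMap.ext_ring (h i)

/-- The Kronecker delta `δ_{m,0}`. -/
def kd (m : ℤ) : ℂ := if m = 0 then 1 else 0

open NWIndex in
/-- The brackets of the basis vectors. They express
`[x ⊗ t^m, y ⊗ t^n] = [x, y] ⊗ t^(m+n) + m (x, y) δ_{m+n,0} k`, `[d_m, x ⊗ t^n] = n x ⊗ t^(m+n)`,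
`[d_m, d_n] = (n - m) d_{m+n} + δ_{m+n,0} (m³ - m)/12 k`, `k` central, where
`[p, q] = r`, `[s, p] = p`, `[s, q] = - q`, `r` is central in `H₄`, and the symmetric form has
`(p, q) = (r, s) = 1` and vanishes on the other pairs of basis vectors. -/
def br : NWIndex → NWIndex → AffVirNW
  | p m, q n => e (r (m + n)) + ((m : ℂ) * kd (m + n)) • e k
  | q m, p n => -e (r (m + n)) + ((m : ℂ) * kd (m + n)) • e k
  | s m, p n => e (p (m + n))
  | p m, s n => -e (p (m + n))
  | s m, q n => -e (q (m + n))
  | q m, s n => e (q (m + n))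
  | r m, s n => ((m : ℂ) * kd (m + n)) • e k
  | s m, r n => ((m : ℂ) * kd (m + n)) • e k
  | d m, p n => (n : ℂ) • e (p (m + n))
  | d m, q n => (n : ℂ) • e (q (m + n))
  | d m, r n => (n : ℂ) • e (r (m + n))
  | d m, s n => (n : ℂ) • e (s (m + n))
  | p m, d n => -((m : ℂ) • e (p (m + n)))
  | q m, d n => -((m : ℂ) • e (q (m + n)))
  | r m, d n => -((m : ℂ) • e (r (m + n)))
  | s m, d n => -((m : ℂ) • e (s (m + n)))
  | d m, d n => ((n : ℂ) - m) • e (d (m + n)) + (kd (m + n) * (((m : ℂ) ^ 3 - m) / 12)) • e k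
  | _, _ => 0

/-- The bilinear extension of `br`. -/
def brLin : AffVirNW →ₗ[ℂ] AffVirNW →ₗ[ℂ] AffVirNW := lin fun i => lin fun j => br i j

theorem brLin_e (i j : NWIndex) : brLin (e i) (e j) = br i j := by
  simp [brLin, lin_e]

theorem kd_cases (m : ℤ) : kd m = 0 ∨ (m : ℂ) = 0 := by
  by_cases h : m = 0 <;> simp [kd, h]

theorem br_antisymm (i j : NWIndex) : br i j = -br j i := by
  rcases i with m | m | m | m | m | _ <;> rcases j with n | n | n | n | n | _ <;>
    simp only [br, neg_zero] <;> rw [add_comm n m] <;>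
    have h := kd_cases (m + n) <;>
    push_cast at h <;>
    rcases h with h | h <;>
    first
    | module
    | (rw [h]; module)
    | (rw [eq_neg_of_add_eq_zero_right h]; module)

theorem brLin_antisymm (x y : AffVirNW) : brLin x y = -brLin y x := by
  have : brLin = -brLin.flip := hom_ext fun i => hom_ext fun j => by
    simp only [LinearMap.neg_apply, LinearMap.flip_apply, brLin_e]
    exact br_antisymm i j
  exact LinearMap.congr_fun₂ this x y

theorem jacobi_e (i j l : NWIndex) : brLin (e i) (brLin (e j) (e l)) =
    brLin (brLin (e i) (e j)) (e l) + brLin (e j) (brLin (e i) (e l)) := by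
  rcases i with a | a | a | a | a | _ <;> rcases j with b | b | b | b | b | _ <;>
    rcases l with c | c | c | c | c | _ <;>
    simp only [brLin_e, br, map_add, map_neg, map_smul, map_zero, LinearMap.add_apply,
      LinearMap.neg_apply, LinearMap.smul_apply, LinearMap.zero_apply, smul_zero, neg_zero,
      add_zero, zero_add, neg_neg] <;>
    try rw [show b + (a + c) = a + (b + c) by ring]
  all_goals try rw [show a + b + c = a + (b + c) by ring]
  all_goals
    have h := kd_cases (a + (b + c))
    push_cast at h ⊢
    rcases h with h | h <;>
    first
    | module
    | (simp only [h]; module)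
    | (rw [show (c : ℂ) = -a - b by linear_combination h]; module)

theorem jacobi (x y z : AffVirNW) :
    brLin x (brLin y z) = brLin (brLin x y) z + brLin y (brLin x z) := by
  let T : AffVirNW →ₗ[ℂ] AffVirNW →ₗ[ℂ] AffVirNW →ₗ[ℂ] AffVirNW :=
    LinearMap.mk₂ ℂ (fun x y => brLin x ∘ₗ brLin y - brLin (brLin x y) - brLin y ∘ₗ brLin x)
      (fun x x' y => by ext z; simp; abel) (fun c x y => by ext z; simp [smul_sub])
      (fun x y y' => by ext z; simp; abel) (fun c x y => by ext z; simp [smul_sub])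
  have hT : T = 0 := hom_ext fun i => hom_ext fun j => hom_ext fun l => by
    simp [T, jacobi_e i j l]
  have h := LinearMap.congr_fun (LinearMap.congr_fun₂ hT x y) z
  simp only [T, LinearMap.mk₂_apply, LinearMap.sub_apply, LinearMap.comp_apply,
    LinearMap.zero_apply] at h
  rw [sub_sub, sub_eq_zero] at h
  exact h

/-- The affine-Virasoro Nappi-Witten Lie algebra. -/
instance instLieRing : LieRing AffVirNW where
  bracket x y := brLin x y
  add_lie x y z := by simp
  lie_add x y z := by simp
  lie_self x := by
    have h : (2 : ℂ) • brLin x x = 0 := by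
      rw [two_smul]
      exact eq_neg_iff_add_eq_zero.mp (brLin_antisymm x x)
    exact (smul_eq_zero.mp h).resolve_left two_ne_zero
  leibniz_lie x y z := jacobi x y z

instance instLieAlgebra : LieAlgebra ℂ AffVirNW where
  lie_smul c x y := (brLin x).map_smul c y

theorem lie_e (i j : NWIndex) : ⁅e i, e j⁆ = br i j := brLin_e i j

/-- The abelian subalgebra `ℂ d₀ ⊕ ℂ s`, where `s = s ⊗ t ^ 0`. -/
def cartan : LieSubalgebra ℂ AffVirNW where
  __ := Submodule.span ℂ {e (NWIndex.d 0), e (NWIndex.s 0)}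
  lie_mem' := by
    intro x y hx hy
    obtain ⟨a, b, rfl⟩ := Submodule.mem_span_pair.mp hx
    obtain ⟨a', b', rfl⟩ := Submodule.mem_span_pair.mp hy
    have : ⁅a • e (NWIndex.d 0) + b • e (NWIndex.s 0),
        a' • e (NWIndex.d 0) + b' • e (NWIndex.s 0)⁆ = (0 : AffVirNW) := by
      simp [lie_e, br]
    rw [this]
    exact Submodule.zero_mem _

/-- `v` is a free generator of `M` over `U(ℂ d₀ ⊕ ℂ s)`, that is, `u ↦ u v` is an isomorphism of
`U(ℂ d₀ ⊕ ℂ s)`-modules from `U(ℂ d₀ ⊕ ℂ s)` onto the restriction of `M`. So `M` is free of rank one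
over `U(ℂ d₀ ⊕ ℂ s)` if and only if it has a free generator. -/
def IsFreeGenerator {M : Type*} [AddCommGroup M] [Module ℂ M] [LieRingModule AffVirNW M]
    [LieModule ℂ AffVirNW M] (v : M) : Prop :=
  Function.Bijective fun u : UniversalEnvelopingAlgebra ℂ cartan =>
    UniversalEnvelopingAlgebra.lift ℂ (LieModule.toEnd ℂ cartan M) u v

/-- The substitution `x(s, d) ↦ x(s - i, d - j)` on `ℂ[s, d] = ℂ[X][Y]`, where `s` is the inner
variable and `d` the outer one. -/
def shift (i j : ℤ) : ℂ[X][Y] →ₐ[ℂ] ℂ[X][Y] :=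
  aevalAeval (R := ℂ) (C (X - C (i : ℂ)) : ℂ[X][Y]) (Y - C (C (j : ℂ)))

/-- The operator `x(s, d) ↦ w(s, d) x(s - i, d - j)`. -/
def shiftMul (w : ℂ[X][Y]) (i j : ℤ) : Module.End ℂ ℂ[X][Y] :=
  LinearMap.mulLeft ℂ w ∘ₗ (shift i j).toLinearMap

/-- The operators on `ℂ[s, d]` by which the basis vectors act:
* `p ⊗ t^m : x(s, d) ↦ α^m P(s) x(s - 1, d - m)`,
* `q ⊗ t^m : x(s, d) ↦ α^m Q(s) x(s + 1, d - m)`,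
* `r ⊗ t^m : x(s, d) ↦ α^m R x(s, d - m)`,
* `s ⊗ t^m : x(s, d) ↦ α^m s x(s, d - m)`,
* `d_m : x(s, d) ↦ α^m (d + m F(s)) x(s, d - m)`,
* `k` acts by zero. -/
def opBasis (α : ℂ) (F P Q : ℂ[X]) (R : ℂ) : NWIndex → Module.End ℂ ℂ[X][Y]
  | .p m => α ^ m • shiftMul (C P) 1 m
  | .q m => α ^ m • shiftMul (C Q) (-1) m
  | .r m => α ^ m • shiftMul (C (C R)) 0 m
  | .s m => α ^ m • shiftMul (C X) 0 m
  | .d m => α ^ m • shiftMul (Y + (m : ℂ) • C F) 0 m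
  | .k => 0

/-- The linear extension of `opBasis` to the whole algebra. -/
def op (α : ℂ) (F P Q : ℂ[X]) (R : ℂ) : AffVirNW →ₗ[ℂ] Module.End ℂ ℂ[X][Y] :=
  lin (opBasis α F P Q R)

/-- The values `(p.1, q.1, r.1)` in the modules on `ℂ[s]` over the Nappi-Witten algebra `H₄` that
are free of rank one over `ℂ[s]`, other than the module on which `p`, `q` and `r` act by zero. -/
inductive NWTriple : ℂ[X] → ℂ[X] → ℂ → Prop
  | g0 (g : ℂ[X]) (hg : g ≠ 0) : NWTriple g 0 0
  | zg (g : ℂ[X]) (hg : g ≠ 0) : NWTriple 0 g 0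
  | hb (a₁ a₂ b : ℂ) (ha₁ : a₁ ≠ 0) (hb₀ : b ≠ 0) :
      NWTriple (C a₁ * X + C a₂) (C b) (-(a₁ * b))
  | bh (a₁ a₂ b : ℂ) (ha₁ : a₁ ≠ 0) (hb₀ : b ≠ 0) :
      NWTriple (C b) (C a₁ * X + C a₂) (-(a₁ * b))
  | ab (a b : ℂ) (ha₀ : a ≠ 0) (hb₀ : b ≠ 0) : NWTriple (C a) (C b) 0

end AffVirNW

end

noncomputable section

namespace AffVirNW

/-! Since `U(ℂ d₀ ⊕ ℂ s)` is `ℂ[s, d]`, a free module of rank one is `ℂ[s, d]` itself, with `s` and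
`d₀` acting by multiplication. Every basis vector is an eigenvector of `ad s` and `ad d₀`, which
forces its operator to be a shift followed by multiplication by its value on `1`, its symbol
(`eq_shiftMul`). A module is thus a family of polynomials subject to the quadratic relations
`SymRel`.

One principle solves them: a polynomial invariant under a nonzero shift of a variable does not
involve that variable. The relations among the `s(m)` and `d_m` produce `α` and make the symbol of
`d_m` linear in `d` (`SymRel.exists_alpha`). The Virasoro relations kill `k` and yield `F`
(`virasoro_cocycle`). The relations with `p` and `q` remove `d` from their symbols and give `P (F(s)
- F(s-1)) = 0 = Q (F(s) - F(s+1))` (`exists_const_of_relations`). What remains is `P(s) Q(s-1) -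
Q(s) P(s+1) = R`, solved by degrees in `nwTriple_of_relation`. If `P` or `Q` is nonzero, `F` has
period one, hence is constant; this separates the two families. Conversely, these three equations
imply all bracket relations (`sym_br`). -/

theorem eq_C_of_comp_X_sub_C {A : Type*} [CommRing A] [IsDomain A] [CharZero A] {f : A[X]} {c : A}
    (hc : c ≠ 0) (h : f.comp (X - C c) = f) : f = C (f.eval 0) := by
  have key : ∀ k : ℕ, f.eval (k * c) = f.eval 0 := by
    intro k
    induction k with
    | zero => simp
    | succ k ih =>
      rw [← ih]
      have := congrArg (eval (((k + 1 : ℕ) : A) * c)) h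
      rw [eval_comp] at this
      rw [← this]
      simp [add_mul]
  apply eq_of_infinite_eval_eq
  apply Set.Infinite.mono (s := Set.range fun k : ℕ => (k : A) * c)
  · rintro _ ⟨k, rfl⟩
    simp [key k]
  · apply Set.infinite_range_of_injective
    intro a b hab
    simpa [hc] using hab

/-! ### Shifts and weighted shifts on `ℂ[s, d]` -/

@[simp] theorem shift_Y (i j : ℤ) : shift i j Y = Y - C (C (j : ℂ)) := by
  simp [shift]

theorem aeval_C_apply (p q : ℂ[X]) : aeval (C q : ℂ[X][Y]) p = C (p.comp q) := by
  have := congrArg (fun f : ℂ[X] →ₐ[ℂ] ℂ[X][Y] => f p)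
    (show aeval (C q : ℂ[X][Y]) = (CAlgHom (R := ℂ) (A := ℂ[X])).comp (aeval q) by ext; simp)
  simpa [comp, aeval_def] using this

@[simp] theorem shift_C (i j : ℤ) (p : ℂ[X]) :
    shift i j (C p) = C (p.comp (X - C (i : ℂ))) := by
  rw [shift, aevalAeval_C, aeval_C_apply]

/-- Brings shifts in `d` alone within reach of `eq_C_of_comp_X_sub_C`, applied over the coefficient
ring `ℂ[s]`. -/
theorem shift_zero_left (j : ℤ) (f : ℂ[X][Y]) : shift 0 j f = f.comp (Y - C (C (j : ℂ))) := by
  induction f using Polynomial.induction_on' with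
  | add f g hf hg => simp [hf, hg]
  | monomial n a => rw [← C_mul_X_pow_eq_monomial]; simp

theorem shift_shift (i j i' j' : ℤ) (f : ℂ[X][Y]) :
    shift i j (shift i' j' f) = shift (i + i') (j + j') f := by
  induction f using Polynomial.induction_on' with
  | add f g hf hg => simp [hf, hg]
  | monomial n a =>
    rw [← C_mul_X_pow_eq_monomial]
    simp [comp_assoc, sub_sub]

@[simp] theorem shift_zero_zero (f : ℂ[X][Y]) : shift 0 0 f = f := by
  simp [shift_zero_left]

theorem shiftMul_apply (w : ℂ[X][Y]) (i j : ℤ) (f : ℂ[X][Y]) :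
    shiftMul w i j f = w * shift i j f := rfl

/-- Through this composition law, commutators of operators become identities between symbols. -/
theorem shiftMul_mul (w w' : ℂ[X][Y]) (i j i' j' : ℤ) :
    shiftMul w i j * shiftMul w' i' j' = shiftMul (w * shift i j w') (i + i') (j + j') := by
  ext1 f
  simp [shiftMul_apply, shift_shift, mul_assoc]

/-- An operator with the commutation relations of a shift is a weighted shift. -/
theorem eq_shiftMul {T : Module.End ℂ ℂ[X][Y]} {i j : ℤ}
    (hX : ∀ f, T (C X * f) = C (X - C (i : ℂ)) * T f)
    (hY : ∀ f, T (Y * f) = (Y - C (C (j : ℂ))) * T f) : T = shiftMul (T 1) i j := by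
  have hC : ∀ (p : ℂ[X]) f, T (C p * f) = shift i j (C p) * T f := by
    intro p
    induction p using Polynomial.induction_on with
    | C a =>
      intro f
      have h (g : ℂ[X][Y]) : C (C a) * g = a • g := by
        rw [← smul_eq_C_mul]; exact algebraMap_smul ℂ[X] a g
      simp [h]
    | add p q hp hq => intro f; simp only [map_add, add_mul, hp, hq]
    | monomial n a h =>
      intro f
      rw [pow_succ, ← mul_assoc, C_mul, mul_assoc, h, hX, map_mul, mul_assoc]
      simp [mul_assoc]
  have key : ∀ g f, T (g * f) = shift i j g * T f := by
    intro g
    induction g using Polynomial.induction_on with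
    | C a => exact hC a
    | add p q hp hq => intro f; simp only [map_add, add_mul, hp, hq]
    | monomial n a h =>
      intro f
      rw [pow_succ, ← mul_assoc, mul_assoc, h, hY, map_mul (shift i j) _ Y, mul_assoc, shift_Y]
  ext1 f
  rw [← mul_one f, key, shiftMul_apply, mul_one, mul_comm]

/-! The enveloping algebra of `cartan`. -/

/-- `s` as an element of the Cartan subalgebra. -/
def cs : cartan := ⟨e (.s 0), Submodule.subset_span (by simp)⟩

/-- `d₀` as an element of the Cartan subalgebra. -/
def cd : cartan := ⟨e (.d 0), Submodule.subset_span (by simp)⟩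

theorem cartan_exists (x : cartan) : ∃ a b : ℂ, x = a • cd + b • cs := by
  obtain ⟨x, hx⟩ := x
  obtain ⟨a, b, rfl⟩ := Submodule.mem_span_pair.mp hx
  exact ⟨a, b, rfl⟩

theorem lie_cd_cs : ⁅cd, cs⁆ = 0 := by
  apply Subtype.ext
  simp [cd, cs, lie_e, br]

theorem cartan_lie (x y : cartan) : ⁅x, y⁆ = 0 := by
  obtain ⟨a, b, rfl⟩ := cartan_exists x
  obtain ⟨a', b', rfl⟩ := cartan_exists y
  have : ⁅cs, cd⁆ = 0 := by rw [← lie_skew, lie_cd_cs, neg_zero]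
  simp [lie_cd_cs, this]

theorem cartan_lieHom_ext {A : Type*} [LieRing A] [LieAlgebra ℂ A] {f g : cartan →ₗ⁅ℂ⁆ A}
    (hd : f cd = g cd) (hs : f cs = g cs) : f = g := by
  ext x
  obtain ⟨a, b, rfl⟩ := cartan_exists x
  simp [hd, hs]

section envelopingAlgebra

attribute [local instance] LieRing.ofAssociativeRing

/-- The inclusion of the Cartan subalgebra into `ℂ[s, d]`. -/
def cartanToPoly : cartan →ₗ⁅ℂ⁆ ℂ[X][Y] where
  toFun x := lin (fun | .d 0 => Y | .s 0 => C X | _ => 0) x.1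
  map_add' x y := by simp
  map_smul' c x := by simp
  map_lie' {x y} := by rw [cartan_lie]; simp [LieRing.of_associative_ring_bracket, mul_comm]

@[simp] theorem cartanToPoly_cd : cartanToPoly cd = Y := by
  simp [cartanToPoly, cd, lin_e]

@[simp] theorem cartanToPoly_cs : cartanToPoly cs = C X := by
  simp [cartanToPoly, cs, lin_e]

/-- The algebra homomorphism `U(ℂ d₀ ⊕ ℂ s) → ℂ[s, d]`. -/
def envToPoly : UniversalEnvelopingAlgebra ℂ cartan →ₐ[ℂ] ℂ[X][Y] :=
  UniversalEnvelopingAlgebra.lift ℂ cartanToPoly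

theorem env_hom_ext {A : Type*} [Ring A] [Algebra ℂ A]
    {f g : UniversalEnvelopingAlgebra ℂ cartan →ₐ[ℂ] A}
    (hd : f (UniversalEnvelopingAlgebra.ι ℂ cd) = g (UniversalEnvelopingAlgebra.ι ℂ cd))
    (hs : f (UniversalEnvelopingAlgebra.ι ℂ cs) = g (UniversalEnvelopingAlgebra.ι ℂ cs)) : f = g :=
  UniversalEnvelopingAlgebra.hom_ext ℂ (cartan_lieHom_ext hd hs)

theorem commute_env : Commute (UniversalEnvelopingAlgebra.ι ℂ cs)
    (UniversalEnvelopingAlgebra.ι ℂ cd) := by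
  have h := LieHom.map_lie (UniversalEnvelopingAlgebra.ι ℂ (L := cartan)) cs cd
  rw [cartan_lie, map_zero, LieRing.of_associative_ring_bracket] at h
  exact (sub_eq_zero.mp h.symm)

/-- The algebra homomorphism `ℂ[s, d] → U(ℂ d₀ ⊕ ℂ s)`. -/
def polyToEnv : ℂ[X][Y] →ₐ[ℂ] UniversalEnvelopingAlgebra ℂ cartan :=
  eval₂AlgHom (aeval (UniversalEnvelopingAlgebra.ι ℂ cs)) (UniversalEnvelopingAlgebra.ι ℂ cd)
    fun a => by
      induction a using Polynomial.induction_on' with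
      | add p q hp hq => rw [map_add]; exact hp.add_left hq
      | monomial n a =>
        rw [aeval_monomial]
        exact Commute.mul_left (Algebra.commutes a _) (commute_env.pow_left n)

@[simp] theorem envToPoly_ι (x : cartan) :
    envToPoly (UniversalEnvelopingAlgebra.ι ℂ x) = cartanToPoly x :=
  UniversalEnvelopingAlgebra.lift_ι_apply ℂ _ _

@[simp] theorem polyToEnv_Y : polyToEnv Y = UniversalEnvelopingAlgebra.ι ℂ cd := by
  simp [polyToEnv]

@[simp] theorem polyToEnv_X : polyToEnv (C X) = UniversalEnvelopingAlgebra.ι ℂ cs := by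
  simp [polyToEnv]

/-- `U(ℂ d₀ ⊕ ℂ s) = ℂ[s, d]`. -/
def envEquiv : UniversalEnvelopingAlgebra ℂ cartan ≃ₐ[ℂ] ℂ[X][Y] :=
  AlgEquiv.ofAlgHom envToPoly polyToEnv
    (algHom_ext' (Polynomial.algHom_ext <|
      (congrArg envToPoly polyToEnv_X).trans ((envToPoly_ι cs).trans cartanToPoly_cs))
      ((congrArg envToPoly polyToEnv_Y).trans ((envToPoly_ι cd).trans cartanToPoly_cd)))
    (env_hom_ext
      ((congrArg polyToEnv ((envToPoly_ι cd).trans cartanToPoly_cd)).trans polyToEnv_Y)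
      ((congrArg polyToEnv ((envToPoly_ι cs).trans cartanToPoly_cs)).trans polyToEnv_X))

end envelopingAlgebra

section
variable {M : Type*} [AddCommGroup M] [Module ℂ M] [LieRingModule AffVirNW M]
    [LieModule ℂ AffVirNW M]

/-- The action of `ℂ[s, d] = U(ℂ d₀ ⊕ ℂ s)` on a module. -/
def polyAct (M : Type*) [AddCommGroup M] [Module ℂ M] [LieRingModule AffVirNW M]
    [LieModule ℂ AffVirNW M] : ℂ[X][Y] →ₐ[ℂ] Module.End ℂ M :=
  (UniversalEnvelopingAlgebra.lift ℂ (LieModule.toEnd ℂ cartan M)).comp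
    (envEquiv.symm : ℂ[X][Y] →ₐ[ℂ] _)

theorem polyAct_Y (m : M) : polyAct M Y m = ⁅e (.d 0), m⁆ := by
  have : envEquiv.symm Y = UniversalEnvelopingAlgebra.ι ℂ cd := polyToEnv_Y
  simp [polyAct, this]
  rfl

theorem polyAct_X (m : M) : polyAct M (C X) m = ⁅e (.s 0), m⁆ := by
  have : envEquiv.symm (C X) = UniversalEnvelopingAlgebra.ι ℂ cs := polyToEnv_X
  simp [polyAct, this]
  rfl

theorem isFreeGenerator_iff (v : M) :
    IsFreeGenerator v ↔ Function.Bijective fun f : ℂ[X][Y] => polyAct M f v := by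
  have : (fun f : ℂ[X][Y] => polyAct M f v) =
    (fun u => UniversalEnvelopingAlgebra.lift ℂ (LieModule.toEnd ℂ cartan M) u v) ∘
      envEquiv.symm := rfl
  rw [this, Function.Bijective.of_comp_iff _ envEquiv.symm.bijective]
  rfl

end

/-! ### The explicit operators form a representation -/

/-- The weight of a basis vector with respect to `s` and `d₀`. -/
def wt : NWIndex → ℤ × ℤ
  | .p m => (1, m)
  | .q m => (-1, m)
  | .r m => (0, m)
  | .s m => (0, m)
  | .d m => (0, m)
  | .k => (0, 0)

/-- The values of `opBasis` on `1`. -/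
def sym (α : ℂ) (F P Q : ℂ[X]) (R : ℂ) : NWIndex → ℂ[X][Y]
  | .p m => C (C (α ^ m)) * C P
  | .q m => C (C (α ^ m)) * C Q
  | .r m => C (C (α ^ m)) * C (C R)
  | .s m => C (C (α ^ m)) * C X
  | .d m => C (C (α ^ m)) * (Y + C (C (m : ℂ)) * C F)
  | .k => 0

theorem smul_eq_CC_mul (a : ℂ) (f : ℂ[X][Y]) : a • f = C (C a) * f := by
  rw [← smul_eq_C_mul]
  exact (algebraMap_smul ℂ[X] a f).symm

theorem opBasis_eq (α : ℂ) (F P Q : ℂ[X]) (R : ℂ) (i : NWIndex) :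
    opBasis α F P Q R i = shiftMul (sym α F P Q R i) (wt i).1 (wt i).2 := by
  ext1 f
  cases i <;>
  simp only [opBasis, sym, wt, LinearMap.smul_apply, shiftMul_apply, smul_eq_CC_mul, mul_assoc,
    LinearMap.zero_apply, zero_mul]

/-- The three hypotheses are what the brackets `[p, d]`, `[q, d]` and `[p, q]` need. The other
brackets only use `α ^ (m + n) = α ^ m * α ^ n`; the central terms vanish with the symbol of `k`. -/
theorem sym_br {α : ℂ} (hα : α ≠ 0) {F P Q : ℂ[X]} {R : ℂ}
    (hFP : P * (F - F.comp (X - C 1)) = 0) (hFQ : Q * (F - F.comp (X + C 1)) = 0)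
    (hR : P * Q.comp (X - C 1) - Q * P.comp (X + C 1) = C R) (i j : NWIndex) :
    sym α F P Q R i * shift (wt i).1 (wt i).2 (sym α F P Q R j) -
      sym α F P Q R j * shift (wt j).1 (wt j).2 (sym α F P Q R i) =
      lin (sym α F P Q R) (br i j) := by
  have hFP' := congrArg (C : ℂ[X] → ℂ[X][Y]) hFP
  have hFQ' := congrArg (C : ℂ[X] → ℂ[X][Y]) hFQ
  have hR' := congrArg (C : ℂ[X] → ℂ[X][Y]) hR
  simp only [C_sub, C_mul, C_0, C_1] at hFP' hFQ' hR'
  rcases i with m | m | m | m | m | _ <;> rcases j with n | n | n | n | n | _ <;>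
    simp only [sym, wt, br, lin_e, zpow_add₀ hα, map_add, map_neg, map_smul, map_mul, map_sub,
      smul_eq_CC_mul, shift_C, shift_Y, C_comp, X_comp, Int.cast_zero, sub_zero, comp_X,
      Int.cast_neg, Int.cast_one, sub_neg_eq_add, mul_zero, add_zero, zero_mul, map_zero,
      Int.cast_add, C_1]
  case p.q => linear_combination C (C (α ^ m)) * C (C (α ^ n)) * hR'
  case q.p => linear_combination -C (C (α ^ m)) * C (C (α ^ n)) * hR'
  case p.d => linear_combination -C (C (α ^ m)) * C (C (α ^ n)) * C (C (n : ℂ)) * hFP'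
  case q.d => linear_combination -C (C (α ^ m)) * C (C (α ^ n)) * C (C (n : ℂ)) * hFQ'
  case d.p => linear_combination C (C (α ^ m)) * C (C (α ^ n)) * C (C (m : ℂ)) * hFP'
  case d.q => linear_combination C (C (α ^ m)) * C (C (α ^ n)) * C (C (m : ℂ)) * hFQ'
  all_goals ring

theorem e_induction {p : AffVirNW → Prop} (zero : p 0) (add : ∀ x y, p x → p y → p (x + y))
    (smul : ∀ (c : ℂ) x, p x → p (c • x)) (basis : ∀ i, p (e i)) (x : AffVirNW) : p x := by
  refine Finsupp.induction_linear (motive := p) x zero add fun i c => ?_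
  have h := smul c _ (basis i)
  rwa [show c • e i = Finsupp.single i c from
    (Finsupp.smul_single c i (1 : ℂ)).trans (by rw [smul_eq_mul, mul_one])] at h

theorem op_lie {α : ℂ} (hα : α ≠ 0) {F P Q : ℂ[X]} {R : ℂ}
    (hFP : P * (F - F.comp (X - C 1)) = 0) (hFQ : Q * (F - F.comp (X + C 1)) = 0)
    (hR : P * Q.comp (X - C 1) - Q * P.comp (X + C 1) = C R) (x y : AffVirNW)
    (f : ℂ[X][Y]) : op α F P Q R ⁅x, y⁆ f =
      op α F P Q R x (op α F P Q R y f) - op α F P Q R y (op α F P Q R x f) := by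
  set ρ := op α F P Q R
  have hρ (i : NWIndex) : ρ (e i) = shiftMul (sym α F P Q R i) (wt i).1 (wt i).2 := by
    rw [← opBasis_eq]
    exact lin_e _ _
  have hk : sym α F P Q R .k = 0 := rfl
  -- The bracket has the sum of the two weights except for its multiples of `k`, which are harmless
  -- because `k` has symbol zero.
  have hwt (i j : NWIndex) : ρ (br i j) f =
      shiftMul (lin (sym α F P Q R) (br i j)) ((wt i).1 + (wt j).1) ((wt i).2 + (wt j).2) f := by
    rcases i with m | m | m | m | m | _ <;> rcases j with n | n | n | n | n | _ <;>
    simp only [br, hρ, lin_e, wt, map_add, map_neg, map_smul, map_zero, LinearMap.add_apply,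
      LinearMap.neg_apply, LinearMap.smul_apply, LinearMap.zero_apply, shiftMul_apply, hk,
      smul_eq_CC_mul, zero_mul, mul_zero, add_zero, zero_add, add_neg_cancel, neg_add_cancel]
    all_goals ring
  induction x using e_induction with
  | zero => simp
  | add x x' hx hx' =>
    simp only [add_lie, map_add, LinearMap.add_apply, hx, hx']
    abel
  | smul c x hx => simp only [smul_lie, map_smul, LinearMap.smul_apply, hx, smul_sub]
  | basis i =>
    induction y using e_induction with
    | zero => simp
    | add x x' hx hx' =>
      simp only [lie_add, map_add, LinearMap.add_apply, hx, hx']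
      abel
    | smul c x hx => simp only [lie_smul, map_smul, LinearMap.smul_apply, hx, smul_sub]
    | basis j =>
      rw [lie_e, hwt, hρ, hρ, ← Module.End.mul_apply, ← Module.End.mul_apply, shiftMul_mul,
        shiftMul_mul, ← sym_br hα hFP hFQ hR, add_comm (wt j).1, add_comm (wt j).2]
      simp only [shiftMul_apply, sub_mul]

theorem exists_module {α : ℂ} (hα : α ≠ 0) {F P Q : ℂ[X]} {R : ℂ}
    (hFP : P * (F - F.comp (X - C 1)) = 0) (hFQ : Q * (F - F.comp (X + C 1)) = 0)
    (hR : P * Q.comp (X - C 1) - Q * P.comp (X + C 1) = C R) :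
    ∃ (_ : LieRingModule AffVirNW ℂ[X][Y]) (_ : LieModule ℂ AffVirNW ℂ[X][Y]),
        (∀ (x : AffVirNW) (f : ℂ[X][Y]), ⁅x, f⁆ = op α F P Q R x f) ∧
        IsFreeGenerator (1 : ℂ[X][Y]) := by
  let I : LieRingModule AffVirNW ℂ[X][Y] :=
    { bracket := fun x f => op α F P Q R x f
      add_lie := by intros; simp
      lie_add := by intros; simp
      leibniz_lie := by
        intro x y f
        change op α F P Q R x (op α F P Q R y f) = _ + op α F P Q R y (op α F P Q R x f)
        simp [op_lie hα hFP hFQ hR] }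
  have hI (x : AffVirNW) (f : ℂ[X][Y]) : ⁅x, f⁆ = op α F P Q R x f := rfl
  let J : LieModule ℂ AffVirNW ℂ[X][Y] :=
    { smul_lie := by intros; simp [hI]
      lie_smul := by intros; simp [hI] }
  refine ⟨I, J, hI, ?_⟩
  rw [isFreeGenerator_iff]
  -- The polynomial action is multiplication, so `f ↦ f · 1` is the identity map.
  have h : polyAct ℂ[X][Y] = Algebra.lmul ℂ ℂ[X][Y] := by
    refine algHom_ext' (Polynomial.algHom_ext ?_) ?_
    · ext1 f
      refine (polyAct_X f).trans ?_
      rw [hI]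
      simp [op, lin_e, opBasis, shiftMul_apply]
    · ext1 f
      rw [polyAct_Y, hI]
      simp [op, lin_e, opBasis, shiftMul_apply]
  have h1 : (fun f : ℂ[X][Y] => polyAct ℂ[X][Y] f 1) = id := by
    ext1 f
    simp [h]
  rw [h1]
  exact Function.bijective_id

/-! ### The functional equation for `P`, `Q`, `R` -/

theorem NWTriple.relation {P Q : ℂ[X]} {R : ℂ} (h : NWTriple P Q R) :
    P * Q.comp (X - C 1) - Q * P.comp (X + C 1) = C R := by
  cases h <;> simp <;> ring

theorem nwTriple_of_relation {P Q : ℂ[X]} {R : ℂ} (h0 : P ≠ 0 ∨ Q ≠ 0)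
    (h : P * Q.comp (X - C 1) - Q * P.comp (X + C 1) = C R) : NWTriple P Q R := by
  by_cases hP : P = 0
  · subst hP
    obtain rfl : R = 0 := by simpa [eq_comm (a := (0 : ℂ[X]))] using h
    exact .zg Q (by simpa using h0)
  by_cases hQ : Q = 0
  · subst hQ
    obtain rfl : R = 0 := by simpa [eq_comm (a := (0 : ℂ[X]))] using h
    exact .g0 P hP
  -- With `G(s) = Q(s) P(s+1)` the relation reads `G(s-1) - G(s) = R`, so `G + R s` has period one.
  -- Hence `G` has degree at most one, and one of `P`, `Q` is constant while the other is at most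
  -- linear.
  have hG := eq_C_of_comp_X_sub_C (f := Q * P.comp (X + C 1) + C R * X) (c := 1) one_ne_zero (by
    rw [add_comp, mul_comp, comp_assoc]
    simp only [add_comp, X_comp, C_comp, mul_comp, sub_add_cancel, comp_X, C_1, one_comp] at h ⊢
    linear_combination h)
  generalize eval 0 (Q * P.comp (X + C 1) + C R * X) = c at hG
  have hdeg : Q.natDegree + P.natDegree ≤ 1 := by
    have h1 : (P.comp (X + C 1)).natDegree = P.natDegree := by
      rw [natDegree_comp, natDegree_X_add_C, mul_one]
    have h2 : P.comp (X + C 1) ≠ 0 := by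
      intro h2
      apply hP
      have := congrArg (fun f => f.comp (X - C 1)) h2
      simpa [comp_assoc] using this
    rw [← h1, ← natDegree_mul hQ h2, show Q * P.comp (X + C 1) = C (-R) * X + C c by
      rw [C_neg]; linear_combination hG]
    exact natDegree_linear_le
  have hlin {A : ℂ[X]} (hA : A.natDegree ≤ 1) : ∃ a b, A = C a * X + C b :=
    exists_eq_X_add_C_of_natDegree_le_one hA
  rcases Nat.eq_zero_or_pos Q.natDegree with hQ0 | hQ0
  · obtain ⟨a₁, a₂, rfl⟩ := hlin (A := P) (by omega)
    obtain ⟨b, rfl⟩ := natDegree_eq_zero.mp hQ0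
    have hb : b ≠ 0 := by simpa using hQ
    obtain rfl : R = -(a₁ * b) := C_injective (by
      rw [← h]; simp; ring)
    by_cases ha : a₁ = 0
    · subst ha
      simpa using NWTriple.ab a₂ b (by simpa using hP) hb
    · exact .hb a₁ a₂ b ha hb
  · obtain ⟨a₁, a₂, rfl⟩ := hlin (A := Q) (by omega)
    obtain ⟨b, rfl⟩ := natDegree_eq_zero.mp (show P.natDegree = 0 by omega)
    have hb : b ≠ 0 := by simpa using hP
    obtain rfl : R = -(a₁ * b) := C_injective (by
      rw [← h]; simp; ring)
    by_cases ha : a₁ = 0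
    · subst ha
      simpa using NWTriple.ab b a₂ hb (by simpa using hQ)
    · exact .bh a₁ a₂ b ha hb

/-! ### Solving the relations between the symbols -/

/-- The relations between the values `w i` on `1` of operators of weights `wt i`
that represent the algebra. -/
def SymRel (w : NWIndex → ℂ[X][Y]) : Prop :=
  ∀ i j, w i * shift (wt i).1 (wt i).2 (w j) - w j * shift (wt j).1 (wt j).2 (w i) =
    lin w (br i j)

theorem kd_of_ne {m : ℤ} (h : m ≠ 0) : kd m = 0 := if_neg h

theorem kd_zero : kd 0 = 1 := if_pos rfl

theorem eq_C_of_shift {f : ℂ[X][Y]} {m : ℤ} (hm : m ≠ 0) (h : shift 0 m f = f) :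
    ∃ p, f = C p := by
  rw [shift_zero_left] at h
  exact ⟨_, eq_C_of_comp_X_sub_C (by simpa using hm) h⟩

theorem eq_linear_of_shift {f : ℂ[X][Y]} {a : ℂ[X]} (h : shift 0 1 f = f - C a) :
    ∃ b, f = C a * Y + C b := by
  obtain ⟨b, hb⟩ := eq_C_of_shift (f := f - C a * Y) one_ne_zero (by
    simp only [map_sub, map_mul, h, shift_C, shift_Y, Int.cast_zero, C_0, sub_zero, comp_X,
      Int.cast_one, C_1]
    ring)
  exact ⟨b, by linear_combination hb⟩

theorem eq_C_of_dvd_C {f : ℂ[X][Y]} {c : ℂ[X]} (hc : c ≠ 0) (h : f ∣ C c) : ∃ p, f = C p := by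
  have := natDegree_le_of_dvd h (by simpa using hc)
  rw [natDegree_C] at this
  exact ⟨_, eq_C_of_natDegree_eq_zero (Nat.le_zero.mp this)⟩

section
variable {w : NWIndex → ℂ[X][Y]} (hw : SymRel w) (hd : w (.d 0) = Y) (hs : w (.s 0) = C X)
include hw

theorem SymRel.ss (m n : ℤ) :
    w (.s m) * shift 0 m (w (.s n)) = w (.s n) * shift 0 n (w (.s m)) := by
  have := hw (.s m) (.s n)
  simpa only [br, wt, map_zero, sub_eq_zero] using this

theorem SymRel.ds (m n : ℤ) :
    w (.d m) * shift 0 m (w (.s n)) - w (.s n) * shift 0 n (w (.d m)) =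
      C (C (n : ℂ)) * w (.s (m + n)) := by
  have := hw (.d m) (.s n)
  simpa only [br, wt, map_smul, lin_e, smul_eq_CC_mul] using this

theorem SymRel.dr (m n : ℤ) :
    w (.d m) * shift 0 m (w (.r n)) - w (.r n) * shift 0 n (w (.d m)) =
      C (C (n : ℂ)) * w (.r (m + n)) := by
  have := hw (.d m) (.r n)
  simpa only [br, wt, map_smul, lin_e, smul_eq_CC_mul] using this

theorem SymRel.dp (m n : ℤ) :
    w (.d m) * shift 0 m (w (.p n)) - w (.p n) * shift 1 n (w (.d m)) =
      C (C (n : ℂ)) * w (.p (m + n)) := by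
  have := hw (.d m) (.p n)
  simpa only [br, wt, map_smul, lin_e, smul_eq_CC_mul] using this

theorem SymRel.dq (m n : ℤ) :
    w (.d m) * shift 0 m (w (.q n)) - w (.q n) * shift (-1) n (w (.d m)) =
      C (C (n : ℂ)) * w (.q (m + n)) := by
  have := hw (.d m) (.q n)
  simpa only [br, wt, map_smul, lin_e, smul_eq_CC_mul] using this

theorem SymRel.dd (m n : ℤ) :
    w (.d m) * shift 0 m (w (.d n)) - w (.d n) * shift 0 n (w (.d m)) =
      C (C ((n : ℂ) - m)) * w (.d (m + n)) +
        C (C (kd (m + n) * (((m : ℂ) ^ 3 - m) / 12))) * w .k := by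
  have := hw (.d m) (.d n)
  simpa only [br, wt, map_add, map_smul, lin_e, smul_eq_CC_mul] using this

theorem SymRel.sp (m n : ℤ) :
    w (.s m) * shift 0 m (w (.p n)) - w (.p n) * shift 1 n (w (.s m)) = w (.p (m + n)) := by
  have := hw (.s m) (.p n)
  simpa only [br, wt, lin_e] using this

theorem SymRel.sq (m n : ℤ) :
    w (.s m) * shift 0 m (w (.q n)) - w (.q n) * shift (-1) n (w (.s m)) = -w (.q (m + n)) := by
  have := hw (.s m) (.q n)
  simpa only [br, wt, lin_e, map_neg] using this

theorem SymRel.rs (m n : ℤ) :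
    w (.r m) * shift 0 m (w (.s n)) - w (.s n) * shift 0 n (w (.r m)) =
      C (C (m * kd (m + n))) * w .k := by
  have := hw (.r m) (.s n)
  simpa only [br, wt, lin_e, map_smul, smul_eq_CC_mul] using this

theorem SymRel.pq :
    w (.p 0) * shift 1 0 (w (.q 0)) - w (.q 0) * shift (-1) 0 (w (.p 0)) = w (.r 0) := by
  have := hw (.p 0) (.q 0)
  simpa [br, wt, lin_e, map_smul, map_add] using this

theorem SymRel.rp :
    w (.r 0) * shift 0 0 (w (.p 0)) - w (.p 0) * shift 1 0 (w (.r 0)) = 0 := by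
  have := hw (.r 0) (.p 0)
  simpa only [br, wt, map_zero] using this

include hs in
-- For `m ≠ 0`, the relation `[d_{-m}, s(m)] = m s(0)` recovers the nonzero symbol of `s(0)`.
theorem SymRel.s_ne_zero (m : ℤ) : w (.s m) ≠ 0 := by
  intro h
  rcases eq_or_ne m 0 with rfl | hm
  · simp [hs] at h
  · have := hw.ds (-m) m
    simp [h, hs, hm] at this

include hs in
-- Because `s(m)` and `s(-m)` commute, the symbol of their product is invariant under `d ↦ d - m`,
-- so it is free of `d`. It is nonzero, so its factors are free of `d` as well.
theorem SymRel.s_const (m : ℤ) : ∃ σ : ℂ[X], w (.s m) = C σ := by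
  rcases eq_or_ne m 0 with rfl | hm
  · exact ⟨X, hs⟩
  · have h1 := hw.ss m (-m)
    obtain ⟨c, hc⟩ := eq_C_of_shift (f := w (.s m) * shift 0 m (w (.s (-m)))) hm (by
      conv_lhs => rw [h1, map_mul, shift_shift]
      simp [mul_comm])
    refine eq_C_of_dvd_C (c := c) ?_ ⟨_, hc.symm⟩
    rintro rfl
    rw [C_0, mul_eq_zero, or_iff_right (hw.s_ne_zero hs m)] at hc
    apply hw.s_ne_zero hs (-m)
    have := congrArg (shift 0 (-m)) hc
    simpa [shift_shift] using this

include hs in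
/-- The operators `s ⊗ t ^ m` and `d_m`, up to the central charge. -/
theorem SymRel.exists_alpha : ∃ (α : ℂ) (B : ℤ → ℂ[X]), α ≠ 0 ∧
    (∀ m, w (.s m) = C (C (α ^ m)) * C X) ∧
    ∀ m, w (.d m) = C (C (α ^ m)) * (Y + C (B m)) := by
  choose σ hσ using hw.s_const hs
  have hσ0 (m : ℤ) : σ m ≠ 0 := by
    intro h
    apply hw.s_ne_zero hs m
    simp [hσ, h]
  have hσX : σ 0 = X := C_injective (by rw [← hσ, hs])
  have hds (m n : ℤ) : C (σ n) * (w (.d m) - shift 0 n (w (.d m))) =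
      C (C (n : ℂ)) * C (σ (m + n)) := by
    have := hw.ds m n
    rw [hσ, hσ, shift_C] at this
    simp only [Int.cast_zero, C_0, sub_zero, comp_X] at this
    linear_combination this
  -- For `n = 1` the difference `w(d_m) - shift 0 1 w(d_m)` divides a nonzero polynomial in `s`, so
  -- it is free of `d`.
  have hlin (m : ℤ) : ∃ A B, w (.d m) = C A * Y + C B := by
    have h := hds m 1
    obtain ⟨a, ha⟩ := eq_C_of_dvd_C (f := w (.d m) - shift 0 1 (w (.d m))) (hσ0 (m + 1))
      ⟨C (σ 1), by simp at h; linear_combination -h⟩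
    exact ⟨a, eq_linear_of_shift (by linear_combination -ha)⟩
  choose A B hAB using hlin
  have hA (m n : ℤ) (hn : n ≠ 0) : σ n * A m = σ (m + n) := by
    have := hds m n
    have hn' : (C (C (n : ℂ)) : ℂ[X][Y]) ≠ 0 := by simpa using hn
    apply C_injective
    apply mul_left_cancel₀ hn'
    rw [← this, hAB]
    simp only [map_add, map_mul, shift_C, shift_Y, Int.cast_zero, C_0, sub_zero, comp_X]
    ring
  -- Going from `σ 1` to `σ 2` and back avoids the excluded index `n = 0`. A unit of `ℂ[s]` is a
  -- nonzero constant, which is `α`.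
  have hunit : A 1 * A (-1) = 1 := by
    apply mul_left_cancel₀ (hσ0 1)
    rw [← mul_assoc, hA 1 1 one_ne_zero, hA (-1) (1 + 1) (by norm_num)]
    norm_num
  obtain ⟨α, hα, hα1⟩ := Polynomial.isUnit_iff.mp (IsUnit.of_mul_eq_one _ hunit)
  have hα0 : α ≠ 0 := hα.ne_zero
  have hstep (n : ℤ) (hn : n ≠ 0) : σ (n + 1) = C α * σ n := by
    rw [hα1, mul_comm, hA 1 n hn, add_comm]
  have h1 : σ 1 = C α * X := by
    -- `hA` says nothing about `n = 0`, so the step from `σ 0` to `σ 1` comes from inverting `A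
    -- (-1)`.
    have := hA (-1) 1 one_ne_zero
    simp only [neg_add_cancel, hσX] at this
    rw [← this, hα1]
    linear_combination (-σ 1) * hunit
  have hstep' (n : ℤ) : σ (n + 1) = C α * σ n := by
    rcases eq_or_ne n 0 with rfl | hn
    · simpa [hσX] using h1
    · exact hstep n hn
  have hσα (m : ℤ) : σ m = C (α ^ m) * X := by
    induction m with
    | zero => simp [hσX]
    | succ n ih => rw [hstep', ih, zpow_add_one₀ hα0, C_mul]; ring
    | pred n ih =>
      apply mul_left_cancel₀ (show (C α : ℂ[X]) ≠ 0 by simpa using hα0)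
      rw [← hstep', sub_add_cancel, ih, zpow_sub_one₀ hα0, ← mul_assoc, ← C_mul]
      congr 2
      field_simp
  have hAα (m : ℤ) : A m = C (α ^ m) := by
    apply mul_left_cancel₀ (hσ0 1)
    rw [hA m 1 one_ne_zero, hstep', hσα m, h1]
    ring
  refine ⟨α, fun m => C ((α ^ m)⁻¹) * B m, hα0, fun m => by rw [hσ, hσα, C_mul], fun m => ?_⟩
  rw [hAB, hAα, mul_add, ← C_mul (a := C (α ^ m)), ← mul_assoc, ← C_mul,
    mul_inv_cancel₀ (zpow_ne_zero m hα0), C_1, one_mul]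

end

/-- The central term vanishes for the pairs `(-1, 1)`, `(-1, 2)`, `(1, -2)`, which determine `B` at
`-1`, `2`, `-2` from `B 1`. The pair `(2, -2)` then leaves `K / 2 = 0`. -/
theorem virasoro_cocycle {V : Type*} [AddCommGroup V] [Module ℂ V] {B : ℤ → V} {K : V}
    (h0 : B 0 = 0) (h : ∀ m n : ℤ, (n : ℂ) • B n - (m : ℂ) • B m - ((n : ℂ) - m) • B (m + n) =
      (kd (m + n) * (((m : ℂ) ^ 3 - m) / 12)) • K) : K = 0 ∧ ∀ m : ℤ, B m = (m : ℂ) • B 1 := by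
  have hm1 : B (-1) = -B 1 := by
    have h := h (-1) 1
    norm_num [h0] at h
    exact eq_neg_of_add_eq_zero_right h
  have h2 : B 2 = (2 : ℂ) • B 1 := by
    have h := h (-1) 2
    norm_num [hm1, kd_of_ne] at h
    linear_combination (norm := module) (1 / 2 : ℂ) • h
  have hm2 : B (-2) = -(2 : ℂ) • B 1 := by
    have h := h 1 (-2)
    norm_num [hm1, kd_of_ne] at h
    linear_combination (norm := module) (-1 / 2 : ℂ) • h
  have hk : K = 0 := by
    have h := h 2 (-2)
    norm_num [h0, h2, hm2, kd_zero] at h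
    linear_combination (norm := module) (-2 : ℂ) • h
  refine ⟨hk, ?_⟩
  simp only [hk, smul_zero] at h
  have hBnat (k : ℕ) : B k = (k : ℂ) • B 1 := by
    induction k using Nat.strong_induction_on with
    | _ k ih =>
    match k with
    | 0 => simp [h0]
    | 1 => simp
    | 2 => simpa using h2
    | k + 3 =>
      -- The coefficient of `B (k + 3)` is `k + 1`. For the step from `B 1` to `B 2` it would
      -- vanish, which is why `B 2` is computed separately.
      have h := h 1 (k + 2 : ℕ)
      rw [ih (k + 2) (by omega), show 1 + ((k + 2 : ℕ) : ℤ) = (k + 3 : ℕ) by push_cast; ring] at h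
      have hk0 : ((k : ℂ) + 1) ≠ 0 := Nat.cast_add_one_ne_zero k
      apply smul_right_injective V hk0
      push_cast at h ⊢
      linear_combination (norm := module) (-1 : ℂ) • h
  intro n
  obtain ⟨k, rfl | rfl⟩ := n.eq_nat_or_neg
  · simpa using hBnat k
  · rcases eq_or_ne k 0 with rfl | hk
    · simp [h0]
    have h := h (-k) k
    rw [neg_add_cancel, h0, hBnat] at h
    apply smul_right_injective V (show (k : ℂ) ≠ 0 by simpa using hk)
    push_cast at h ⊢
    linear_combination (norm := module) h

/-- The operators `p ⊗ t ^ m` (for `ε = 1`) and `q ⊗ t ^ m` (for `ε = -1`). -/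
theorem exists_const_of_relations {α : ℂ} (hα : α ≠ 0) {F : ℂ[X]} {ε : ℤ} (hε : ε * ε = 1)
    {T : ℤ → ℂ[X][Y]}
    (h1 : ∀ m n : ℤ, C (C (α ^ m)) * C X * shift 0 m (T n) -
      T n * shift ε n (C (C (α ^ m)) * C X) = C (C (ε : ℂ)) * T (m + n))
    (h2 : ∀ m n : ℤ, C (C (α ^ m)) * (Y + C (C (m : ℂ)) * C F) * shift 0 m (T n) -
      T n * shift ε n (C (C (α ^ m)) * (Y + C (C (m : ℂ)) * C F)) = C (C (n : ℂ)) * T (m + n)) :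
    ∃ b : ℂ[X], (∀ m, T m = C (C (α ^ m)) * C b) ∧ b * (F - F.comp (X - C (ε : ℂ))) = 0 := by
  set t := T 0 with ht
  have hCα (m : ℤ) : (C (C (α ^ m)) : ℂ[X][Y]) ≠ 0 := by simpa using zpow_ne_zero m hα
  have hεε : (C (C (ε : ℂ)) * C (C (ε : ℂ)) : ℂ[X][Y]) = 1 := by
    rw [← C_mul, ← C_mul]
    exact_mod_cast congrArg (fun x : ℤ => (C (C (x : ℂ)) : ℂ[X][Y])) hε
  -- `[s(m), T 0] = ε T m` expresses every `T m` through `t`.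
  have hT (m : ℤ) : T m =
      C (C (α ^ m)) * (t + C (C (ε : ℂ)) * C X * (shift 0 m t - t)) := by
    have h := h1 m 0
    rw [add_zero] at h
    simp only [map_mul, shift_C, C_comp, X_comp, C_sub] at h
    linear_combination (-C (C (ε : ℂ))) * h + (-T m + C (C (α ^ m)) * t) * hεε
  -- Inserting `hT` into `[s(1), T 1] = ε T 2` leaves the second difference of `t` times the nonzero
  -- factor `s (ε s - 1)`. So `t = a d + b`.
  have hΔ : shift 0 2 t - 2 * shift 0 1 t + t = 0 := by
    have h := h1 1 1
    rw [hT 1, hT (1 + 1)] at h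
    simp only [map_mul, map_add, map_sub, shift_C, C_comp, X_comp, shift_shift, add_zero,
      Int.cast_zero, C_0, sub_zero, Int.reduceAdd] at h
    have h3 : C (C (α ^ (1 : ℤ))) * (C (C (α ^ (1 : ℤ))) * (C (X * (C (ε : ℂ) * X - 1)) *
        (shift 0 2 t - 2 * shift 0 1 t + t))) = 0 := by
      rw [show C (C (α ^ (2 : ℤ))) = (C (C (α ^ (1 : ℤ))) * C (C (α ^ (1 : ℤ))) : ℂ[X][Y]) by
        rw [← C_mul, ← C_mul, ← zpow_add₀ hα]; rfl] at h
      simp only [C_mul, C_sub, C_1]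
      linear_combination h + C (C (α ^ (1 : ℤ))) * C (C (α ^ (1 : ℤ))) * C X *
        (shift 0 2 t - shift 0 1 t) * hεε
    have h4 : (X * (C (ε : ℂ) * X - 1) : ℂ[X]) ≠ 0 := by
      refine mul_ne_zero X_ne_zero fun h => ?_
      simpa using congrArg (eval 0) h
    have h5 : (C (X * (C (ε : ℂ) * X - 1)) : ℂ[X][Y]) ≠ 0 := fun h => h4 (C_eq_zero.mp h)
    exact (((mul_eq_zero.mp h3).resolve_left (hCα 1) |> mul_eq_zero.mp).resolve_left (hCα 1)
      |> mul_eq_zero.mp).resolve_left h5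
  obtain ⟨a, ha⟩ := eq_C_of_shift (f := t - shift 0 1 t) one_ne_zero (by
    simp only [map_sub, shift_shift, add_zero, Int.reduceAdd]
    linear_combination -hΔ)
  obtain ⟨b, hb⟩ := eq_linear_of_shift (f := t) (a := a) (by linear_combination -ha)
  have h2' (m : ℤ) : (Y + C (C (m : ℂ)) * C F) * (t - C (C (m : ℂ)) * C a) -
      t * (Y + C (C (m : ℂ)) * C (F.comp (X - C (ε : ℂ)))) = 0 := by
    have h := h2 m 0
    apply mul_left_cancel₀ (hCα m)
    rw [← ht, hb] at h
    rw [hb]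
    simp only [map_mul, map_add, shift_C, C_comp, shift_Y, Int.cast_zero, C_0, sub_zero,
      zero_mul, comp_X] at h
    linear_combination h
  have hp := h2' 1
  have hm := h2' (-1)
  -- Adding the relations for `m = 1` and `m = -1` leaves only `-2 F a = 0`. If `a ≠ 0`, then `F =
  -- 0`, and `hZ` becomes `a d = 0`, which is absurd.
  simp only [Int.cast_one, C_1, Int.cast_neg, C_neg] at hp hm
  have hFa : (C (F * a) : ℂ[X][Y]) = 0 := by
    rw [C_mul]
    have : (2 : ℂ[X][Y]) * (C F * C a) = 0 := by linear_combination -hp - hm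
    simpa using this
  have hZ : t * (C F - C (F.comp (X - C (ε : ℂ)))) = C a * Y := by
    rw [C_mul] at hFa
    linear_combination hp + hFa
  obtain rfl : a = 0 := by
    by_contra ha0
    have hF : F = 0 := by simpa [ha0] using hFa
    rw [hF] at hZ
    simp [ha0] at hZ
  rw [C_0, zero_mul, zero_add] at hb
  refine ⟨b, fun m => ?_, ?_⟩
  · rw [hT m, hb]
    simp
  · rw [hb] at hZ
    apply C_injective
    rw [C_mul, C_sub, hZ]
    simp

section
variable {w : NWIndex → ℂ[X][Y]} (hw : SymRel w) (hd : w (.d 0) = Y) (hs : w (.s 0) = C X)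
include hw hd hs

theorem SymRel.classification : ∃ (α : ℂ) (F P Q : ℂ[X]) (R : ℂ), α ≠ 0 ∧
    w = sym α F P Q R ∧ P * (F - F.comp (X - C 1)) = 0 ∧ Q * (F - F.comp (X + C 1)) = 0 ∧
    P * Q.comp (X - C 1) - Q * P.comp (X + C 1) = C R := by
  obtain ⟨α, B, hα, hS, hD⟩ := hw.exists_alpha hs
  have hCα (m : ℤ) : (C (C (α ^ m)) : ℂ[X][Y]) ≠ 0 := by simpa using zpow_ne_zero m hα
  have hB0 : B 0 = 0 := by
    have := hD 0
    rw [hd] at this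
    simpa using this
  have hdd (m n : ℤ) : C (C (α ^ m)) * C (C (α ^ n)) * (C (C (n : ℂ)) * C (B n) -
      C (C (m : ℂ)) * C (B m) - (C (C (n : ℂ)) - C (C (m : ℂ))) * C (B (m + n))) =
      C (C (kd (m + n) * (((m : ℂ) ^ 3 - m) / 12))) * w .k := by
    have h := hw.dd m n
    simp only [hD, map_mul, map_add, shift_C, shift_Y, Int.cast_zero, C_0, sub_zero,
      comp_X, zpow_add₀ hα, C_sub] at h ⊢
    linear_combination h
  obtain ⟨hk, hB⟩ := virasoro_cocycle (B := fun m => (C (B m) : ℂ[X][Y])) (K := w .k)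
    (by simp [hB0]) fun m n => by
      simp only [smul_eq_CC_mul]
      -- The factor `α ^ m * α ^ n` is `1` when `m + n = 0`; otherwise the right side is zero and
      -- the factor cancels.
      rcases eq_or_ne (m + n) 0 with h | h
      · rw [← hdd m n, ← C_mul (a := C (α ^ m)), ← C_mul (a := α ^ m), ← zpow_add₀ hα, h,
          zpow_zero, C_sub, C_sub, C_1, C_1, one_mul]
      · have h3 := hdd m n
        rw [kd_of_ne h, zero_mul, C_0, C_0, zero_mul] at h3 ⊢
        rw [C_sub, C_sub]
        exact (mul_eq_zero.mp h3).resolve_left (mul_ne_zero (hCα m) (hCα n))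
  set F := B 1
  replace hD (m : ℤ) : w (.d m) = C (C (α ^ m)) * (Y + C (C (m : ℂ)) * C F) := by
    rw [hD, hB, smul_eq_CC_mul]
  -- As `k` acts by zero, `r(m)` commutes with `s(1)`, whose symbol is `α s`; so the symbol of
  -- `r(m)` has period one in `d`.
  have hRc (m : ℤ) : ∃ ρ, w (.r m) = C ρ := by
    apply eq_C_of_shift one_ne_zero
    have h := hw.rs m 1
    rw [hk, mul_zero, hS] at h
    simp only [map_mul, shift_C, Int.cast_zero, C_0, sub_zero, comp_X] at h
    have hX : (C (C (α ^ (1 : ℤ))) * C X : ℂ[X][Y]) ≠ 0 := mul_ne_zero (hCα 1) (by simp)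
    apply mul_left_cancel₀ hX
    linear_combination -h
  choose ρ hρ using hRc
  have hρ1 (m n : ℤ) (hn : n ≠ 0) : ρ (m + n) = C (α ^ m) * ρ n := by
    have h := hw.dr m n
    rw [hD, hρ, hρ] at h
    simp only [map_mul, map_add, shift_C, shift_Y, Int.cast_zero, C_0, sub_zero,
      comp_X] at h
    apply C_injective
    apply mul_left_cancel₀ (show (C (C (n : ℂ)) : ℂ[X][Y]) ≠ 0 by simpa using hn)
    rw [C_mul]
    linear_combination -h
  -- Both `ρ m` and `ρ 0` are compared with `ρ 1`, since `hρ1` excludes `n = 0`.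
  have hρα (m : ℤ) : ρ m = C (α ^ m) * ρ 0 := by
    have h3 := hρ1 (m - 1) 1 one_ne_zero
    have h4 := hρ1 (-1) 1 one_ne_zero
    rw [sub_add_cancel] at h3
    rw [neg_add_cancel] at h4
    rw [h3, h4, ← mul_assoc, ← C_mul, ← zpow_add₀ hα, sub_eq_add_neg]
  obtain ⟨P, hP, hFP⟩ := exists_const_of_relations hα (F := F) (ε := 1) rfl
    (T := fun m => w (.p m))
    (fun m n => by have := hw.sp m n; rw [hS] at this; rw [this]; simp)
    (fun m n => by have := hw.dp m n; rwa [hD] at this)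
  obtain ⟨Q, hQ, hFQ⟩ := exists_const_of_relations hα (F := F) (ε := -1) rfl
    (T := fun m => w (.q m))
    (fun m n => by have := hw.sq m n; rw [hS] at this; rw [this]; simp; ring)
    (fun m n => by have := hw.dq m n; rwa [hD] at this)
  simp only [Int.cast_neg, Int.cast_one, C_neg, sub_neg_eq_add] at hFP hFQ
  have hpq : P * Q.comp (X - C 1) - Q * P.comp (X + C 1) = ρ 0 := by
    have h := hw.pq
    simp only [hP, hQ, hρ] at h
    apply C_injective
    simpa using h
  -- If `P = 0`, then `hpq` gives `ρ 0 = 0`; otherwise `[r, p] = 0` makes `ρ 0` invariant under `s ↦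
  -- s - 1`.
  have hR : ∃ R, ρ 0 = C R := by
    by_cases hP0 : P = 0
    · exact ⟨0, by rw [← hpq, hP0]; simp⟩
    · have h := hw.rp
      simp only [hP, hρ] at h
      refine ⟨_, eq_C_of_comp_X_sub_C (c := 1) one_ne_zero ?_⟩
      apply mul_left_cancel₀ hP0
      apply C_injective
      simp only [shift_C, Int.cast_zero, Int.cast_one, C_0, sub_zero, comp_X, zpow_zero, C_1,
        one_mul, C_mul] at h ⊢
      linear_combination -h
  obtain ⟨R, hR⟩ := hR
  refine ⟨α, F, P, Q, R, hα, ?_, hFP, hFQ, hpq.trans hR⟩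
  ext1 i
  cases i with
  | p m => exact hP m
  | q m => exact hQ m
  | r m => rw [hρ, hρα, hR, C_mul]; rfl
  | s m => exact hS m
  | d m => exact hD m
  | k => exact hk

end

/-! ### From modules to symbols -/

theorem br_s_zero (i : NWIndex) : br (.s 0) i = ((wt i).1 : ℂ) • e i := by
  cases i <;> simp [br, wt]

theorem br_d_zero (i : NWIndex) : br (.d 0) i = ((wt i).2 : ℂ) • e i := by
  cases i <;> simp [br, wt]

/-- A representation on `ℂ[s, d]` in which `s` and `d₀` act by multiplication
is one of the explicit ones. -/
theorem rep_classification (ρ : AffVirNW →ₗ[ℂ] Module.End ℂ ℂ[X][Y])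
    (hρ : ∀ x y f, ρ ⁅x, y⁆ f = ρ x (ρ y f) - ρ y (ρ x f))
    (hd : ∀ f, ρ (e (.d 0)) f = Y * f) (hs : ∀ f, ρ (e (.s 0)) f = C X * f) :
    ∃ (α : ℂ) (F P Q : ℂ[X]) (R : ℂ), α ≠ 0 ∧
      ρ = op α F P Q R ∧ P * (F - F.comp (X - C 1)) = 0 ∧ Q * (F - F.comp (X + C 1)) = 0 ∧
      P * Q.comp (X - C 1) - Q * P.comp (X + C 1) = C R := by
  have hsh (i : NWIndex) : ρ (e i) = shiftMul (ρ (e i) 1) (wt i).1 (wt i).2 := by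
    refine eq_shiftMul (fun f => ?_) (fun f => ?_)
    · have h := hρ (e (.s 0)) (e i) f
      rw [lie_e, br_s_zero, map_smul, LinearMap.smul_apply, hs, hs, smul_eq_CC_mul] at h
      rw [C_sub]
      linear_combination h
    · have h := hρ (e (.d 0)) (e i) f
      rw [lie_e, br_d_zero, map_smul, LinearMap.smul_apply, hd, hd, smul_eq_CC_mul] at h
      linear_combination h
  have hlin (x : AffVirNW) : ρ x 1 = lin (fun i => ρ (e i) 1) x := by
    refine LinearMap.congr_fun (f := (LinearMap.applyₗ 1).comp ρ) (hom_ext fun i => ?_) x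
    rw [lin_e]
    rfl
  -- The relations are the bracket identities evaluated at `1`.
  have hw : SymRel fun i => ρ (e i) 1 := fun i j => by
    rw [← hlin, ← lie_e, hρ, hsh i, hsh j]
    simp only [shiftMul_apply, map_one, mul_one]
  obtain ⟨α, F, P, Q, R, hα, h, h1⟩ := hw.classification (by simp [hd]) (by simp [hs])
  refine ⟨α, F, P, Q, R, hα, ?_, h1⟩
  ext1 x
  induction x using e_induction with
  | zero => rw [map_zero, map_zero]
  | add x y hx hy => rw [map_add, map_add, hx, hy]
  | smul c x hx => rw [map_smul, map_smul, hx]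
  | basis i => rw [op, lin_e, hsh, opBasis_eq, ← h]

/-- A module with free generator `v` is isomorphic to one of the explicit modules. -/
theorem module_classification {M : Type*} [AddCommGroup M] [Module ℂ M] [LieRingModule AffVirNW M]
    [LieModule ℂ AffVirNW M] {v : M} (hv : IsFreeGenerator v) :
    ∃ (α : ℂ) (F P Q : ℂ[X]) (R : ℂ), α ≠ 0 ∧
      (∃ φ : M ≃ₗ[ℂ] ℂ[X][Y], φ v = 1 ∧
        ∀ (x : AffVirNW) (m : M), φ ⁅x, m⁆ = op α F P Q R x (φ m)) ∧
      P * (F - F.comp (X - C 1)) = 0 ∧ Q * (F - F.comp (X + C 1)) = 0 ∧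
      P * Q.comp (X - C 1) - Q * P.comp (X + C 1) = C R := by
  rw [isFreeGenerator_iff] at hv
  let ψ : ℂ[X][Y] ≃ₗ[ℂ] M :=
    LinearEquiv.ofBijective ((LinearMap.applyₗ v).comp (polyAct M).toLinearMap) hv
  have hψ (f : ℂ[X][Y]) : ψ f = polyAct M f v := rfl
  let ρ : AffVirNW →ₗ[ℂ] Module.End ℂ ℂ[X][Y] :=
    LinearMap.mk₂ ℂ (fun x f => ψ.symm ⁅x, ψ f⁆) (by intros; simp) (by intros; simp)
      (by intros; simp) (by intros; simp)
  have hρ (x : AffVirNW) (f : ℂ[X][Y]) : ρ x f = ψ.symm ⁅x, ψ f⁆ := rfl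
  obtain ⟨α, F, P, Q, R, hα, h, h1⟩ := rep_classification ρ
    (fun x y f => by simp [hρ])
    (fun f => by
      rw [hρ, LinearEquiv.symm_apply_eq, ← polyAct_Y, hψ, hψ, map_mul]
      rfl)
    (fun f => by
      rw [hρ, LinearEquiv.symm_apply_eq, ← polyAct_X, hψ, hψ, map_mul]
      rfl)
  refine ⟨α, F, P, Q, R, hα, ⟨ψ.symm, ?_, fun x m => ?_⟩, h1⟩
  · rw [LinearEquiv.symm_apply_eq, hψ, map_one]
    rfl
  · rw [← h, hρ, LinearEquiv.apply_symm_apply]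

theorem eq_C_of_mul_eq_zero {A B : ℂ[X]} {c : ℂ} (hc : c ≠ 0) (hA : A ≠ 0)
    (h : A * (B - B.comp (X - C c)) = 0) : ∃ b, B = C b :=
  ⟨_, eq_C_of_comp_X_sub_C hc
    (sub_eq_zero.mp ((mul_eq_zero.mp h).resolve_left hA)).symm⟩

theorem op_p_zero_one (α : ℂ) (F P Q : ℂ[X]) (R : ℂ) : op α F P Q R (e (.p 0)) 1 = C P := by
  simp [op, lin_e, opBasis_eq, shiftMul_apply, sym]

theorem op_q_zero_one (α : ℂ) (F P Q : ℂ[X]) (R : ℂ) : op α F P Q R (e (.q 0)) 1 = C Q := by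
  simp [op, lin_e, opBasis_eq, shiftMul_apply, sym]

end AffVirNW

end

open AffVirNW in
theorem theorem4p10 :
    -- the members of the two families are modules, free of rank one with generator `1`
    (∀ (α lam : ℂ) (P Q : ℂ[X]) (R : ℂ), α ≠ 0 → NWTriple P Q R →
      ∃ (_ : LieRingModule AffVirNW ℂ[X][Y]) (_ : LieModule ℂ AffVirNW ℂ[X][Y]),
        (∀ (x : AffVirNW) (f : ℂ[X][Y]), ⁅x, f⁆ = op α (C lam) P Q R x f) ∧
        IsFreeGenerator (1 : ℂ[X][Y])) ∧
    (∀ (α : ℂ) (F : ℂ[X]), α ≠ 0 →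
      ∃ (_ : LieRingModule AffVirNW ℂ[X][Y]) (_ : LieModule ℂ AffVirNW ℂ[X][Y]),
        (∀ (x : AffVirNW) (f : ℂ[X][Y]), ⁅x, f⁆ = op α F 0 0 0 x f) ∧
        IsFreeGenerator (1 : ℂ[X][Y])) ∧
    -- every module that is free of rank one is isomorphic to one of them
    (∀ (M : Type*) [AddCommGroup M] [Module ℂ M] [LieRingModule AffVirNW M]
      [LieModule ℂ AffVirNW M] (v : M), IsFreeGenerator v →
      ((⁅e (NWIndex.p 0), v⁆ ≠ 0 ∨ ⁅e (NWIndex.q 0), v⁆ ≠ 0) →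
        ∃ (α lam : ℂ) (P Q : ℂ[X]) (R : ℂ), α ≠ 0 ∧ NWTriple P Q R ∧
          ∃ φ : M ≃ₗ[ℂ] ℂ[X][Y], φ v = 1 ∧
            ∀ (x : AffVirNW) (m : M), φ ⁅x, m⁆ = op α (C lam) P Q R x (φ m)) ∧
      ((⁅e (NWIndex.p 0), v⁆ = 0 ∧ ⁅e (NWIndex.q 0), v⁆ = 0) →
        ∃ (α : ℂ) (F : ℂ[X]), α ≠ 0 ∧
          ∃ φ : M ≃ₗ[ℂ] ℂ[X][Y], φ v = 1 ∧
            ∀ (x : AffVirNW) (m : M), φ ⁅x, m⁆ = op α F 0 0 0 x (φ m))) := by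
  refine ⟨fun α lam P Q R hα h => exists_module hα (by simp) (by simp) h.relation,
    fun α F hα => exists_module hα (by simp) (by simp) (by simp), ?_⟩
  intro M _ _ _ _ v hv
  obtain ⟨α, F, P, Q, R, hα, ⟨φ, hφ1, hφ⟩, hFP, hFQ, hR⟩ := module_classification hv
  have hp : φ ⁅e (NWIndex.p 0), v⁆ = C P := by rw [hφ, hφ1, op_p_zero_one]
  have hq : φ ⁅e (NWIndex.q 0), v⁆ = C Q := by rw [hφ, hφ1, op_q_zero_one]
  constructor
  · intro h
    replace h : P ≠ 0 ∨ Q ≠ 0 := by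
      rwa [← φ.map_ne_zero_iff, ← φ.map_ne_zero_iff, hp, hq, C_ne_zero, C_ne_zero] at h
    -- A nonzero `P` or `Q` cancels from its equation with `F`, leaving `F` periodic.
    obtain ⟨lam, rfl⟩ : ∃ lam, F = C lam := by
      rcases h with h | h
      · exact eq_C_of_mul_eq_zero one_ne_zero h hFP
      · exact eq_C_of_mul_eq_zero (c := -1) (by norm_num) h (by rwa [C_neg, sub_neg_eq_add])
    exact ⟨α, lam, P, Q, R, hα, nwTriple_of_relation h hR, φ, hφ1, hφ⟩
  · rintro ⟨h1, h2⟩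
    obtain rfl : P = 0 := C_eq_zero.mp (by rw [← hp, h1, map_zero])
    obtain rfl : Q = 0 := C_eq_zero.mp (by rw [← hq, h2, map_zero])
    obtain rfl : R = 0 := C_eq_zero.mp (by simpa using hR.symm)
    exact ⟨α, F, hα, φ, hφ1, hφ⟩
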